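/- All matrices are real, vector inequalities are componentwise, and for $A\in\mathbb R^{n\times n}$ and $\alpha\subseteq\{1,\dots,n\}$, $A_{\alpha\alpha}$ denotes the principal submatrix with rows and columns in $\alpha$ and $\bar\alpha$ the complement of $\alpha$. For $q\in\mathbb R^n$ let $\mathrm{SOL}(q,A)=\{z\ge 0: q+Az\ge 0,\ z^T(q+Az)=0\}$. We use the following classes. - $A\in P_0$ if all principal minors of $A$ are nonnegative. - $A\in E_0$ (resp. $A\in E$) if for every $0\ne x\ge 0$ there is $i$ with $x_i>0$ and $(Ax)_i\ge 0$ (resp. $(Ax)_i>0$). - $A$ is almost $E$ if every principal submatrix of $A$ of order $n-1$ is in $E$ but $A\notin E$. - $A\in E_0^s$ (semimonotone star) if $A\in E_0$, and $x\ge 0$, $Ax\ge 0$, $x^TAx=0$ imply $A^Tx\le 0$. - $A\in\tilde E_0^s$ if $A\in E_0^s$ and, for all $x\in\mathrm{SOL}(0,A)$ and all $i$, $(A^Tx)_i\ne 0$ implies $(Ax)_i\ne 0$. - $A$ is completely $\tilde E_0^s$ if all its nonempty principal submatrices are in $\tilde E_0^s$. - $A\in L_2$ if for every $0\ne x\ge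 0$ with $Ax\ge 0$ and $x^TAx=0$ there are diagonal matrices $D_1,D_2\ge 0$ with $D_2x\ne 0$ and $(D_1A+A^TD_2)x=0$. - $A\in Q_0$ if for every $q\in\mathbb R^n$ for which some $z\ge 0$ satisfies $q+Az\ge 0$, one has $\mathrm{SOL}(q,A)\neq\emptyset$. A legitimate principal pivot transform of $A$ is a matrix $M$ obtained from some $\alpha\subseteq\{1,\dots,n\}$ with $\det A_{\alpha\alpha}\ne 0$ (where $\alpha=\emptyset$ is allowed and gives $M=A$) by $$M_{\alpha\alpha}=A_{\alpha\alpha}^{-1},\quad M_{\alpha\bar\alpha}=-A_{\alpha\alpha}^{-1}A_{\alpha\bar\alpha},\quad M_{\bar\alpha\alpha}=A_{\bar\alpha\alpha}A_{\alpha\alpha}^{-1},\quad M_{\bar\alpha\bar\alpha}=A_{\bar\alpha\bar\alpha}-A_{\bar\alpha\alpha}A_{\alpha\alpha}^{-1}A_{\alpha\bar\alpha}.$$ Theorem. Let $A\in\mathbb R^{n\times n}\cap\tilde E_0^s$. Then $A\in E_0\cap L_2$. If, moreover, every legitimate principal pivot transform of $A$ is either almost $E$ or completely $\tilde E_0^s$,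 then $A\in P_0$ and $A\in Q_0$. -/

import Mathlib

open Matrix

namespace LCP

variable {ι : Type*} [Fintype ι]

/-- The feasible set of the linear complementarity problem `LCP(q, A)`:
all `z ≥ 0` with `w = q + A z ≥ 0`. -/
def FEA (q : ι → ℝ) (A : Matrix ι ι ℝ) : Set (ι → ℝ) :=
  {z | 0 ≤ z ∧ 0 ≤ q + A *ᵥ z}

/-- The solution set of `LCP(q, A)`: the feasible `z` with `zᵀ (q + A z) = 0`. -/
def SOL (q : ι → ℝ) (A : Matrix ι ι ℝ) : Set (ι → ℝ) :=
  {z | z ∈ FEA q A ∧ z ⬝ᵥ (q + A *ᵥ z) = 0}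

/-- The principal submatrix `A_{αα}`. -/
def principal {κ : Type*} (A : Matrix κ κ ℝ) (α : Finset κ) :
    Matrix {i // i ∈ α} {i // i ∈ α} ℝ :=
  A.submatrix Subtype.val Subtype.val

/-- `P₀`: all principal minors are nonnegative (the empty minor equals `1`). -/
def IsP0 [DecidableEq ι] (A : Matrix ι ι ℝ) : Prop :=
  ∀ α : Finset ι, 0 ≤ (principal A α).det

/-- `E₀`: semimonotone matrices. -/
def IsE0 (A : Matrix ι ι ℝ) : Prop :=
  ∀ x : ι → ℝ, 0 ≤ x → x ≠ 0 → ∃ i, 0 < x i ∧ 0 ≤ (A *ᵥ x) i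

/-- `E`: strictly semimonotone matrices. -/
def IsE (A : Matrix ι ι ℝ) : Prop :=
  ∀ x : ι → ℝ, 0 ≤ x → x ≠ 0 → ∃ i, 0 < x i ∧ 0 < (A *ᵥ x) i

/-- Almost `E`: with `n` the order of `A`, every principal submatrix of order `n - 1` is
in `E`, but `A` itself is not. -/
def IsAlmostE (A : Matrix ι ι ℝ) : Prop :=
  (∀ α : Finset ι, α.card + 1 = Fintype.card ι → IsE (principal A α)) ∧ ¬ IsE A

/-- `E₀ˢ`: semimonotone star matrices. -/
def IsE0s (A : Matrix ι ι ℝ) : Prop :=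
  IsE0 A ∧ ∀ x : ι → ℝ, x ⬝ᵥ (A *ᵥ x) = 0 → 0 ≤ A *ᵥ x → 0 ≤ x → Aᵀ *ᵥ x ≤ 0

/-- The subclass `Ẽ₀ˢ` of `E₀ˢ`. -/
def IsE0sTilde (A : Matrix ι ι ℝ) : Prop :=
  IsE0s A ∧ ∀ x ∈ SOL 0 A, ∀ i, (Aᵀ *ᵥ x) i ≠ 0 → (A *ᵥ x) i ≠ 0

/-- Completely `Ẽ₀ˢ`: all (nonempty) principal submatrices are in `Ẽ₀ˢ`. -/
def IsCompletelyE0sTilde (A : Matrix ι ι ℝ) : Prop :=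
  ∀ α : Finset ι, α.Nonempty → IsE0sTilde (principal A α)

/-- `L₂`-matrices; the nonnegative diagonal matrices `D₁`, `D₂` are given by their diagonals. -/
def IsL2 [DecidableEq ι] (A : Matrix ι ι ℝ) : Prop :=
  ∀ x : ι → ℝ, x ≠ 0 → 0 ≤ x → 0 ≤ A *ᵥ x → x ⬝ᵥ (A *ᵥ x) = 0 →
    ∃ d₁ d₂ : ι → ℝ, 0 ≤ d₁ ∧ 0 ≤ d₂ ∧ diagonal d₂ *ᵥ x ≠ 0 ∧
      (diagonal d₁ * A + Aᵀ * diagonal d₂) *ᵥ x = 0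

/-- `Q₀`: `LCP(q, A)` has a solution whenever it is feasible. -/
def IsQ0 (A : Matrix ι ι ℝ) : Prop :=
  ∀ q : ι → ℝ, (FEA q A).Nonempty → (SOL q A).Nonempty

/-- The principal pivot transform of `A` with respect to `α`, in block form with respect to the
partition of the index set into `α` and its complement. It is meaningful (legitimate) only if
`A_{αα}` is nonsingular. -/
noncomputable def ppt [DecidableEq ι] (A : Matrix ι ι ℝ) (α : Finset ι) : Matrix ι ι ℝ :=
  Matrix.reindex (Equiv.sumCompl (· ∈ α)) (Equiv.sumCompl (· ∈ α))
    (fromBlocks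
      ((principal A α)⁻¹)
      (-((principal A α)⁻¹ * A.toBlock (· ∈ α) (· ∉ α)))
      (A.toBlock (· ∉ α) (· ∈ α) * (principal A α)⁻¹)
      (A.toBlock (· ∉ α) (· ∉ α)
        - A.toBlock (· ∉ α) (· ∈ α) * (principal A α)⁻¹ * A.toBlock (· ∈ α) (· ∉ α)))

/-- `M` is a legitimate principal pivot transform of `A` (the choice `α = ∅` gives `A`). -/
def IsLegitimatePPT [DecidableEq ι] (A M : Matrix ι ι ℝ) : Prop :=
  ∃ α : Finset ι, (principal A α).det ≠ 0 ∧ M = ppt A α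

end LCP

open Filter Topology

namespace LCP

/-! ### Principal minors and pivot transforms -/

section Principal

variable {ι : Type*} [DecidableEq ι]

/-! For `P₀`, suppose `det A_ββ < 0` and take `γ ⊆ β` of largest size with positive minor. Schur's
formula makes every nonempty minor of `M = ppt A γ` inside `β \ γ` nonpositive. The diagonal of `M`
there is then `≤ 0`, so `M` is not almost `E` but completely `Ẽ₀ˢ`, and that diagonal vanishes. The
order-two conditions (`IsE0sTilde.pair_eq_zero`) kill the off-diagonal entries too, contradicting
`det M_(β \ γ) < 0`.

For `Q₀`, `A + εI` has a uniform `P`-constant, so its problem is solvable. As `ε → 0`, either a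
subsequence of solutions converges to a solution, or the normalized solutions yield a direction `x`
with `Aᵀx ≤ 0` and `xᵀq < 0`, which rules out feasibility (`IsE0sTilde.fea_eq_empty`). -/

theorem det_principal_empty (A : Matrix ι ι ℝ) : (principal A ∅).det = 1 :=
  have : IsEmpty {i // i ∈ (∅ : Finset ι)} := ⟨fun i => Finset.notMem_empty _ i.2⟩
  det_isEmpty

theorem det_principal_singleton (A : Matrix ι ι ℝ) (i : ι) : (principal A {i}).det = A i i := by
  rw [det_eq_elem_of_card_eq_one (by simp) ⟨i, by simp⟩]
  rfl

theorem det_principal_pair (A : Matrix ι ι ℝ) {i j : ι} (hij : i ≠ j) :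
    (principal A {i, j}).det = A i i * A j j - A i j * A j i := by
  let f : Fin 2 → {k // k ∈ ({i, j} : Finset ι)} := ![⟨i, by simp⟩, ⟨j, by simp⟩]
  have hf : Function.Bijective f := by
    constructor
    · intro a b
      fin_cases a <;> fin_cases b <;> simp [f, hij, hij.symm]
    · rintro ⟨k, hk⟩
      rcases Finset.mem_insert.1 hk with rfl | hk
      · exact ⟨0, rfl⟩
      · exact ⟨1, Subtype.ext (Finset.mem_singleton.1 hk).symm⟩
  rw [← det_submatrix_equiv_self (Equiv.ofBijective f hf), det_fin_two]
  rfl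

theorem ppt_apply_of_notMem (A : Matrix ι ι ℝ) (α : Finset ι) {i j : ι} (hi : i ∉ α)
    (hj : j ∉ α) :
    ppt A α i j = A i j - (A.toBlock (· ∉ α) (· ∈ α) * (principal A α)⁻¹ *
      A.toBlock (· ∈ α) (· ∉ α)) ⟨i, hi⟩ ⟨j, hj⟩ := by
  simp [ppt, Equiv.sumCompl_symm_apply_of_neg, hi, hj]

/-- Schur's determinantal formula for principal pivot transforms. -/
theorem det_principal_union (A : Matrix ι ι ℝ) {γ δ : Finset ι} (h : Disjoint γ δ)
    (hγ : (principal A γ).det ≠ 0) :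
    (principal A (γ ∪ δ)).det = (principal A γ).det * (principal (ppt A γ) δ).det := by
  have : Invertible (principal A γ) := invertibleOfIsUnitDet _ (isUnit_iff_ne_zero.2 hγ)
  have key : (principal A (γ ∪ δ)).submatrix (Equiv.Finset.union γ δ h)
      (Equiv.Finset.union γ δ h) = fromBlocks (principal A γ)
        (A.submatrix Subtype.val Subtype.val) (A.submatrix Subtype.val Subtype.val)
        (principal A δ) := by
    ext (i | i) (j | j) <;> rfl
  rw [← det_submatrix_equiv_self (Equiv.Finset.union γ δ h), key, det_fromBlocks₁₁]
  congr 2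
  ext ⟨i, hi⟩ ⟨j, hj⟩
  have hi' := Finset.disjoint_right.1 h hi
  have hj' := Finset.disjoint_right.1 h hj
  change _ = ppt A γ i j
  rw [ppt_apply_of_notMem A γ hi' hj', invOf_eq_nonsing_inv]
  rfl

end Principal

section Fintype

variable {ι : Type*} [Fintype ι]

/-! ### Principal submatrices -/

theorem principal_mulVec_of_support (A : Matrix ι ι ℝ) (α : Finset ι) (x : ι → ℝ)
    (hx : ∀ i, i ∉ α → x i = 0) (i : {i // i ∈ α}) :
    (principal A α *ᵥ fun j => x j) i = (A *ᵥ x) i := by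
  simp only [mulVec, dotProduct, principal, submatrix_apply]
  rw [Finset.sum_coe_sort α (fun j => A i j * x j)]
  exact Finset.sum_subset (Finset.subset_univ α) fun j _ hj => by simp [hx j hj]

theorem continuous_mulVec (A : Matrix ι ι ℝ) : Continuous fun x : ι → ℝ => A *ᵥ x :=
  continuous_const.matrix_mulVec continuous_id

theorem dotProduct_mulVec_eq_transpose_mulVec (A : Matrix ι ι ℝ) (x z : ι → ℝ) :
    x ⬝ᵥ (A *ᵥ z) = (Aᵀ *ᵥ x) ⬝ᵥ z := by
  rw [dotProduct_mulVec, mulVec_transpose]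

theorem SOL.mul_eq_zero {q z : ι → ℝ} {A : Matrix ι ι ℝ} (hz : z ∈ SOL q A) (i : ι) :
    z i * (q + A *ᵥ z) i = 0 :=
  (Finset.sum_eq_zero_iff_of_nonneg fun j _ => mul_nonneg (hz.1.1 j) (hz.1.2 j)).1 hz.2 i
    (Finset.mem_univ i)

/-! ### Uniform `P`-constants -/

/-- `c` is a uniform `P`-constant for `A`. -/
def HasPConst (A : Matrix ι ι ℝ) (c : ℝ) : Prop :=
  ∀ x : ι → ℝ, x ≠ 0 → ∃ i, c * ‖x‖ ^ 2 ≤ x i * (A *ᵥ x) i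

/-- Compactness of the unit sphere, then homogeneity of degree two. The sup norm of the positive
parts serves as a continuous substitute for the largest product. -/
theorem exists_hasPConst {A : Matrix ι ι ℝ} (hA : ∀ x : ι → ℝ, x ≠ 0 → ∃ i, 0 < x i * (A *ᵥ x) i) :
    ∃ c, 0 < c ∧ HasPConst A c := by
  let F : (ι → ℝ) → ℝ := fun x => ‖fun i => max 0 (x i * (A *ᵥ x) i)‖
  have hF : Continuous F := by
    refine continuous_norm.comp (continuous_pi fun i => continuous_const.max ?_)
    exact (continuous_apply i).mul ((continuous_apply i).comp (continuous_mulVec A))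
  obtain ⟨c, hc, hcF⟩ := (isCompact_sphere (0 : ι → ℝ) 1).exists_forall_le' hF.continuousOn
    (a := 0) (fun x hx => by
      obtain ⟨i, hi⟩ := hA x (by rintro rfl; simp at hx)
      refine norm_pos_iff.2 fun h0 => ?_
      have := congrFun h0 i
      simp only [Pi.zero_apply] at this
      exact hi.not_ge (max_eq_left_iff.1 this))
  have hunit : ∀ y ∈ Metric.sphere (0 : ι → ℝ) 1, ∃ i, c ≤ y i * (A *ᵥ y) i := by
    intro y hy
    by_contra! hlt
    refine ((pi_norm_lt_iff hc).2 fun i => ?_).not_ge (hcF y hy)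
    rw [Real.norm_of_nonneg (le_max_left _ _)]
    exact max_lt hc (hlt i)
  refine ⟨c, hc, fun x hx => ?_⟩
  have hn : 0 < ‖x‖ := norm_pos_iff.2 hx
  obtain ⟨i, hi⟩ := hunit (‖x‖⁻¹ • x) (by simp [norm_smul, hn.ne'])
  refine ⟨i, ?_⟩
  rw [mulVec_smul, Pi.smul_apply, Pi.smul_apply, smul_eq_mul, smul_eq_mul] at hi
  calc c * ‖x‖ ^ 2 ≤ (‖x‖⁻¹ * x i * (‖x‖⁻¹ * (A *ᵥ x) i)) * ‖x‖ ^ 2 := by gcongr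
    _ = x i * (A *ᵥ x) i := by field_simp

/-- Solutions depend on `q` in a Lipschitz way. -/
theorem HasPConst.norm_sub_le {A : Matrix ι ι ℝ} {c : ℝ} (hc : 0 < c) (hA : HasPConst A c)
    {q q' z z' : ι → ℝ} (hz : z ∈ SOL q A) (hz' : z' ∈ SOL q' A) :
    ‖z - z'‖ ≤ c⁻¹ * ‖q - q'‖ := by
  by_cases h0 : z - z' = 0
  · rw [h0, norm_zero]; positivity
  obtain ⟨i, hi⟩ := hA _ h0
  have hn : 0 < ‖z - z'‖ := norm_pos_iff.2 h0
  have e1 := SOL.mul_eq_zero hz i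
  have e2 := SOL.mul_eq_zero hz' i
  have p1 := mul_nonneg (hz.1.1 i) (hz'.1.2 i)
  have p2 := mul_nonneg (hz'.1.1 i) (hz.1.2 i)
  rw [mulVec_sub] at hi
  simp only [Pi.add_apply, Pi.sub_apply] at hi e1 e2 p1 p2
  -- By complementarity the product of `z - z'` and the difference of the slacks is minus a sum of
  -- nonnegative cross terms.
  have h1 : c * ‖z - z'‖ ^ 2 ≤ -((z - z') i * (q - q') i) := by
    simp only [Pi.sub_apply]
    linarith
  have h2 : -((z - z') i * (q - q') i) ≤ ‖z - z'‖ * ‖q - q'‖ := by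
    refine (neg_le_abs _).trans ?_
    rw [abs_mul]
    exact mul_le_mul (norm_le_pi_norm (z - z') i) (norm_le_pi_norm (q - q') i) (abs_nonneg _)
      (norm_nonneg _)
  have h3 : c * ‖z - z'‖ ≤ ‖q - q'‖ := by
    refine le_of_mul_le_mul_left ?_ hn
    nlinarith
  rw [inv_mul_eq_div, le_div_iff₀ hc]
  linarith

variable [DecidableEq ι]

/-! ### Diagonal entries -/

theorem mulVec_single_one_apply (A : Matrix ι ι ℝ) (i k : ι) :
    (A *ᵥ Pi.single i 1) k = A k i := by
  simp

theorem IsE0.diag_nonneg {A : Matrix ι ι ℝ} (hA : IsE0 A) (i : ι) : 0 ≤ A i i := by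
  obtain ⟨k, hk, hk'⟩ := hA (Pi.single i 1) (Pi.single_nonneg.2 zero_le_one) (by simp)
  obtain rfl : k = i := by
    by_contra h
    simp [Pi.single_eq_of_ne h] at hk
  rwa [mulVec_single_one_apply] at hk'

theorem IsE.diag_pos {A : Matrix ι ι ℝ} (hA : IsE A) (i : ι) : 0 < A i i := by
  obtain ⟨k, hk, hk'⟩ := hA (Pi.single i 1) (Pi.single_nonneg.2 zero_le_one) (by simp)
  obtain rfl : k = i := by
    by_contra h
    simp [Pi.single_eq_of_ne h] at hk
  rwa [mulVec_single_one_apply] at hk'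

theorem IsCompletelyE0sTilde.diag_nonneg {κ : Type*} [DecidableEq κ] {A : Matrix κ κ ℝ}
    (hA : IsCompletelyE0sTilde A) (i : κ) : 0 ≤ A i i :=
  (hA {i} (Finset.singleton_nonempty i)).1.1.diag_nonneg ⟨i, Finset.mem_singleton_self i⟩

/-- From order two on, every index lies in some set of size `n - 1`; at order one those sets are
empty. -/
theorem IsAlmostE.diag_pos {A : Matrix ι ι ℝ} (hA : IsAlmostE A) (hι : 2 ≤ Fintype.card ι)
    (i : ι) : 0 < A i i := by
  obtain ⟨α, hα, hcard⟩ := Finset.exists_superset_card_eq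
    (s := {i}) (n := Fintype.card ι - 1) (by simp; omega) (by omega)
  exact (hA.1 α (by omega)).diag_pos ⟨i, hα (by simp)⟩

/-! ### `P₀` -/

/-- The unit vector `eᵢ` solves the homogeneous problem of the submatrix; both star conditions are
read off at coordinate `j`. -/
theorem IsE0sTilde.pair_nonpos {A : Matrix ι ι ℝ} {i j : ι}
    (hA : IsE0sTilde (principal A {i, j})) (hi : A i i = 0) (hji : 0 ≤ A j i) :
    A i j ≤ 0 ∧ (A i j ≠ 0 → A j i ≠ 0) := by
  set α : Finset ι := {i, j}
  let x : {k // k ∈ α} → ℝ := fun k => (Pi.single i 1 : ι → ℝ) k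
  have hsupp : ∀ k, k ∉ α → (Pi.single i 1 : ι → ℝ) k = 0 := fun k hk =>
    Pi.single_eq_of_ne (by rintro rfl; exact hk (by simp [α])) 1
  have hAx : ∀ k, (principal A α *ᵥ x) k = A k i := fun k =>
    (principal_mulVec_of_support A α _ hsupp k).trans (mulVec_single_one_apply A i k)
  have hAtx : ∀ k, ((principal A α)ᵀ *ᵥ x) k = A i k := fun k =>
    (principal_mulVec_of_support Aᵀ α _ hsupp k).trans (mulVec_single_one_apply Aᵀ i k)
  have hx : 0 ≤ x := fun k => (Pi.single_nonneg.2 zero_le_one : (0 : ι → ℝ) ≤ Pi.single i 1) k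
  have hAx0 : 0 ≤ principal A α *ᵥ x := by
    rintro ⟨k, hk⟩
    rw [hAx]
    rcases Finset.mem_insert.1 hk with rfl | hk
    · exact hi.ge
    · rw [Finset.mem_singleton] at hk
      subst hk
      exact hji
  have hxAx : x ⬝ᵥ (principal A α *ᵥ x) = 0 := by
    refine Finset.sum_eq_zero fun k _ => ?_
    rw [hAx]
    by_cases hk : (k : ι) = i
    · rw [hk, hi, mul_zero]
    · simp [x, Pi.single_eq_of_ne hk]
  have hj : j ∈ α := by simp [α]
  have h1 := hA.1.2 x hxAx hAx0 hx ⟨j, hj⟩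
  have h2 := hA.2 x ⟨⟨hx, by simpa using hAx0⟩, by simpa using hxAx⟩ ⟨j, hj⟩
  rw [hAtx] at h1 h2
  rw [hAx] at h2
  exact ⟨h1, h2⟩

theorem IsE0.pair_nonneg {A : Matrix ι ι ℝ} {i j : ι} (hij : i ≠ j)
    (hA : IsE0 (principal A {i, j})) (hi : A i i = 0) (hj : A j j = 0) :
    0 ≤ A i j ∨ 0 ≤ A j i := by
  set α : Finset ι := {i, j}
  let y : ι → ℝ := Pi.single i 1 + Pi.single j 1
  have hy : 0 ≤ y := add_nonneg (Pi.single_nonneg.2 zero_le_one) (Pi.single_nonneg.2 zero_le_one)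
  have hsupp : ∀ k, k ∉ α → y k = 0 := by
    intro k hk
    have h1 : k ≠ i := by rintro rfl; exact hk (by simp [α])
    have h2 : k ≠ j := by rintro rfl; exact hk (by simp [α])
    simp [y, h1, h2]
  have hy0 : (fun k : {k // k ∈ α} => y k) ≠ 0 := by
    intro h
    have := congrFun h ⟨i, by simp [α]⟩
    simp [y, hij] at this
  obtain ⟨⟨k, hk⟩, -, h⟩ := hA (fun k => y k) (fun k => hy k) hy0
  rw [principal_mulVec_of_support A α y hsupp, mulVec_add, Pi.add_apply,
    mulVec_single_one_apply, mulVec_single_one_apply] at h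
  rcases Finset.mem_insert.1 hk with rfl | hk
  · left; simpa [hi] using h
  · right; simpa [Finset.mem_singleton.1 hk, hj] using h

/-- Split on the sign of `A j i`. If negative, semimonotonicity and the product force `A i j = 0`,
which the tilde condition at `eⱼ` forbids; otherwise `eᵢ` is the test vector. -/
theorem IsE0sTilde.pair_eq_zero {A : Matrix ι ι ℝ} {i j : ι} (hij : i ≠ j)
    (hA : IsE0sTilde (principal A {i, j})) (hi : A i i = 0) (hj : A j j = 0)
    (h : 0 ≤ A i j * A j i) : A i j = 0 := by
  have hA' : IsE0sTilde (principal A {j, i}) := by rwa [Finset.pair_comm]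
  rcases lt_trichotomy (A j i) 0 with hji | hji | hji
  · rcases hA.1.1.pair_nonneg hij hi hj with hij' | hji'
    · exact absurd (le_antisymm (by nlinarith) hij') ((hA'.pair_nonpos hj hij').2 hji.ne)
    · exact absurd hji hji'.not_gt
  · by_contra hne
    exact (hA.pair_nonpos hi hji.ge).2 hne hji
  · have := (hA.pair_nonpos hi hji.le).1
    nlinarith

theorem isP0_of_ppt {A : Matrix ι ι ℝ} (hι : 2 ≤ Fintype.card ι)
    (h : ∀ M, IsLegitimatePPT A M → IsAlmostE M ∨ IsCompletelyE0sTilde M) : IsP0 A := by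
  intro β
  by_contra! hβ
  obtain ⟨γ, hγ, hmax⟩ := Finset.exists_max_image
    (β.powerset.filter fun γ => 0 < (principal A γ).det) Finset.card ⟨∅, by simp⟩
  rw [Finset.mem_filter, Finset.mem_powerset] at hγ
  obtain ⟨hγβ, hγpos⟩ := hγ
  set M := ppt A γ with hM
  have hminor : ∀ δ ⊆ β \ γ, δ.Nonempty → (principal M δ).det ≤ 0 := by
    intro δ hδ hne
    have hdisj : Disjoint γ δ := Finset.disjoint_of_subset_right hδ Finset.disjoint_sdiff
    by_contra! hpos
    have h1 : γ ∪ δ ⊆ β := Finset.union_subset hγβ (hδ.trans Finset.sdiff_subset)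
    have h2 := hmax (γ ∪ δ) (by
      rw [Finset.mem_filter, Finset.mem_powerset, det_principal_union A hdisj hγpos.ne']
      exact ⟨h1, mul_pos hγpos hpos⟩)
    rw [Finset.card_union_of_disjoint hdisj] at h2
    have := hne.card_pos
    omega
  have hdet := det_principal_union A (Finset.disjoint_sdiff : Disjoint γ (β \ γ)) hγpos.ne'
  rw [Finset.union_sdiff_of_subset hγβ, ← hM] at hdet
  have hne : (β \ γ).Nonempty := by
    rw [Finset.nonempty_iff_ne_empty]
    intro h0
    rw [h0, det_principal_empty, mul_one] at hdet
    linarith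
  have hdiag : ∀ i ∈ β \ γ, M i i ≤ 0 := fun i hi =>
    (det_principal_singleton M i).ge.trans <|
      hminor {i} (Finset.singleton_subset_iff.2 hi) (Finset.singleton_nonempty i)
  obtain ⟨i₀, hi₀⟩ := hne
  have hMc : IsCompletelyE0sTilde M :=
    (h M ⟨γ, hγpos.ne', hM⟩).resolve_left fun hE =>
      (hE.diag_pos hι i₀).not_ge (hdiag i₀ hi₀)
  have hdiag0 : ∀ i ∈ β \ γ, M i i = 0 := fun i hi =>
    le_antisymm (hdiag i hi) (hMc.diag_nonneg i)
  have hzero : ∀ j ∈ β \ γ, M i₀ j = 0 := by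
    intro j hj
    by_cases hij : i₀ = j
    · subst hij; exact hdiag0 i₀ hi₀
    refine (hMc {i₀, j} (by simp)).pair_eq_zero hij (hdiag0 _ hi₀) (hdiag0 _ hj) ?_
    have := hminor {i₀, j} (Finset.insert_subset hi₀ (Finset.singleton_subset_iff.2 hj)) (by simp)
    rw [det_principal_pair M hij, hdiag0 _ hi₀] at this
    linarith
  rw [det_eq_zero_of_row_eq_zero (A := principal M (β \ γ)) ⟨i₀, hi₀⟩ fun j => hzero j j.2,
    mul_zero] at hdet
  exact hβ.ne hdet

theorem IsE0.isP0_of_card_le_one {A : Matrix ι ι ℝ} (hA : IsE0 A) (hι : Fintype.card ι ≤ 1) :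
    IsP0 A := by
  intro α
  have hα : α.card ≤ 1 := (Finset.card_le_univ α).trans hι
  rcases α.eq_empty_or_nonempty with rfl | ⟨i, hi⟩
  · simp
  · obtain rfl : α = {i} := Finset.eq_singleton_iff_unique_mem.2
      ⟨hi, fun j hj => Finset.card_le_one.1 hα j hj i hi⟩
    rw [det_principal_singleton]
    exact hA.diag_nonneg i

/-! ### The class `L₂` -/

theorem IsE0sTilde.isL2 {A : Matrix ι ι ℝ} (hA : IsE0sTilde A) : IsL2 A := by
  intro x hx0 hx hAx hxAx
  have h1 := hA.1.2 x hxAx hAx hx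
  have h2 := hA.2 x ⟨⟨hx, by simpa using hAx⟩, by simpa using hxAx⟩
  -- `D₂ = I` leaves one equation per coordinate for `D₁`; where `(Ax)ᵢ = 0`, the tilde condition
  -- gives `(Aᵀx)ᵢ = 0`.
  refine ⟨fun i => -(Aᵀ *ᵥ x) i / (A *ᵥ x) i, fun _ => 1,
    fun i => div_nonneg (neg_nonneg.2 (h1 i)) (hAx i), fun _ => zero_le_one, ?_, ?_⟩
  · simpa using hx0
  · ext i
    rw [add_mulVec, ← mulVec_mulVec, diagonal_one, mul_one, Pi.add_apply, mulVec_diagonal,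
      Pi.zero_apply]
    by_cases h : (A *ᵥ x) i = 0
    · rw [h, mul_zero, zero_add]
      by_contra hne
      exact h2 i hne h
    · rw [div_mul_cancel₀ _ h, neg_add_cancel]

/-! ### Sign reversal and `P₀` -/

theorem det_piecewise_diagonal (A : Matrix ι ι ℝ) (d : ι → ℝ) (s : Finset ι) :
    det (fun i => s.piecewise A (diagonal d) i) =
      (principal A s).det * ∏ i : {i // i ∉ s}, d i := by
  have h1 : toSquareBlockProp (fun i => s.piecewise A (diagonal d) i) (· ∈ s) = principal A s := by
    ext i j
    exact congrFun (s.piecewise_eq_of_mem A (diagonal d) i.2) j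
  have h2 : toSquareBlockProp (fun i => s.piecewise A (diagonal d) i) (fun i => ¬ i ∈ s) =
      diagonal fun i : {i // i ∉ s} => d i := by
    ext i j
    refine (congrFun (s.piecewise_eq_of_notMem A (diagonal d) i.2) j).trans ?_
    simp only [diagonal_apply, Subtype.ext_iff]
  rw [twoBlockTriangular_det (fun i => s.piecewise A (diagonal d) i) (· ∈ s)]
  · rw [h1, h2, det_diagonal]
    congr!
  intro i hi j hj
  have hij : i ≠ j := by rintro rfl; exact hi hj
  exact (congrFun (s.piecewise_eq_of_notMem A (diagonal d) hi) j).trans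
    (diagonal_apply_ne d hij)

/-- Row multilinearity expands the determinant into principal minors times complementary products of
`d`; the empty minor supplies a positive term. -/
theorem IsP0.det_add_diagonal_pos {A : Matrix ι ι ℝ} (hA : IsP0 A) {d : ι → ℝ}
    (hd : ∀ i, 0 < d i) : 0 < (A + diagonal d).det := by
  have h : (A + diagonal d).det = ∑ s : Finset ι, det (fun i => s.piecewise A (diagonal d) i) :=
    (detRowAlternating (n := ι) (R := ℝ)).map_add_univ A (diagonal d)
  rw [h]
  simp only [det_piecewise_diagonal]
  refine Finset.sum_pos' (fun s _ => mul_nonneg (hA s) (Finset.prod_nonneg fun i _ => (hd i).le))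
    ⟨∅, Finset.mem_univ _, ?_⟩
  rw [det_principal_empty, one_mul]
  exact Finset.prod_pos fun i _ => hd i

/-- A `P₀`-matrix does not strictly reverse the sign of any nonzero vector. -/
theorem IsP0.exists_mul_mulVec_nonneg {A : Matrix ι ι ℝ} (hA : IsP0 A) {x : ι → ℝ} (hx : x ≠ 0) :
    ∃ i, x i ≠ 0 ∧ 0 ≤ x i * (A *ᵥ x) i := by
  by_contra! h
  -- Clearing the rows where `x` vanishes preserves `P₀`, and `d` is chosen so that `B + diagonal d`
  -- annihilates `x`.
  let B : Matrix ι ι ℝ := fun i j => if x i = 0 then 0 else A i j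
  let d : ι → ℝ := fun i => if x i = 0 then 1 else -(A *ᵥ x) i / x i
  have hB : IsP0 B := by
    intro α
    by_cases hα : ∃ i ∈ α, x i = 0
    · obtain ⟨i, hi, hxi⟩ := hα
      rw [det_eq_zero_of_row_eq_zero (A := principal B α) ⟨i, hi⟩
        fun j => (if_pos hxi : B i j = 0)]
    · push Not at hα
      have : principal B α = principal A α := by
        ext i j
        exact if_neg (hα i i.2)
      rw [this]
      exact hA α
  have hd : ∀ i, 0 < d i := by
    intro i
    by_cases hi : x i = 0
    · simp [d, hi]
    · have h1 := h i hi
      simp only [d, hi, if_false]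
      have h2 : -(A *ᵥ x) i / x i = -(x i * (A *ᵥ x) i) / (x i) ^ 2 := by
        field_simp
      rw [h2]
      exact div_pos (neg_pos.2 h1) (by positivity)
  refine (hB.det_add_diagonal_pos hd).ne' (exists_mulVec_eq_zero_iff.1 ⟨x, hx, ?_⟩)
  ext i
  rw [add_mulVec, Pi.add_apply, mulVec_diagonal, Pi.zero_apply]
  by_cases hi : x i = 0
  · simp [B, mulVec, dotProduct, hi]
  · have : (B *ᵥ x) i = (A *ᵥ x) i := by simp [B, mulVec, dotProduct, hi]
    rw [this]
    simp only [d, hi, if_false]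
    field_simp
    ring

/-! ### Solvability for matrices with a uniform `P`-constant -/

theorem add_smul_one_mulVec (A : Matrix ι ι ℝ) (t : ℝ) (x : ι → ℝ) :
    (A + t • (1 : Matrix ι ι ℝ)) *ᵥ x = A *ᵥ x + t • x := by
  rw [add_mulVec, smul_mulVec, one_mulVec]

theorem HasPConst.add_smul_one {A : Matrix ι ι ℝ} {c t : ℝ} (hA : HasPConst A c) (ht : 0 ≤ t) :
    HasPConst (A + t • (1 : Matrix ι ι ℝ)) c := by
  intro x hx
  obtain ⟨i, hi⟩ := hA x hx
  refine ⟨i, hi.trans ?_⟩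
  rw [add_smul_one_mulVec, Pi.add_apply, Pi.smul_apply, smul_eq_mul]
  nlinarith [mul_nonneg ht (mul_self_nonneg (x i))]

theorem IsP0.exists_hasPConst {A : Matrix ι ι ℝ} (hA : IsP0 A) {ε : ℝ} (hε : 0 < ε) :
    ∃ c, 0 < c ∧ HasPConst (A + ε • (1 : Matrix ι ι ℝ)) c := by
  refine LCP.exists_hasPConst fun x hx => ?_
  obtain ⟨i, hi, hi'⟩ := hA.exists_mul_mulVec_nonneg hx
  refine ⟨i, ?_⟩
  rw [add_smul_one_mulVec, Pi.add_apply, Pi.smul_apply, smul_eq_mul]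
  have : 0 < ε * (x i * x i) := mul_pos hε (mul_self_pos.2 hi)
  nlinarith

/-- A solution `z` is a fixed point of `z ↦ f (q - s • z)`, with `f` the solution map of `A`. Since
`f` is `c⁻¹`-Lipschitz and `s < c`, this is a contraction. -/
theorem exists_sol_sub_smul_one {A : Matrix ι ι ℝ} {c s : ℝ} (hA : HasPConst A c)
    (hs : 0 ≤ s) (hsc : s < c) (hsol : ∀ q, (SOL q A).Nonempty) (q : ι → ℝ) :
    (SOL q (A - s • (1 : Matrix ι ι ℝ))).Nonempty := by
  have hc : 0 < c := hs.trans_lt hsc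
  choose f hf using hsol
  have hcontr : ContractingWith (Real.toNNReal (c⁻¹ * s)) fun z => f (q - s • z) := by
    constructor
    · rw [Real.toNNReal_lt_one, inv_mul_eq_div, div_lt_one hc]
      exact hsc
    · refine LipschitzWith.of_dist_le_mul fun z z' => ?_
      rw [dist_eq_norm, dist_eq_norm, Real.coe_toNNReal _ (by positivity)]
      refine (hA.norm_sub_le hc (hf _) (hf _)).trans (le_of_eq ?_)
      rw [sub_sub_sub_cancel_left, ← smul_sub, norm_smul, Real.norm_of_nonneg hs,
        norm_sub_rev, mul_assoc]
  have hz := hf (q - s • ContractingWith.fixedPoint _ hcontr)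
  have hfix : f (q - s • ContractingWith.fixedPoint _ hcontr) = _ :=
    hcontr.fixedPoint_isFixedPt
  rw [hfix] at hz
  set z := ContractingWith.fixedPoint _ hcontr
  have e : q + (A - s • (1 : Matrix ι ι ℝ)) *ᵥ z = q - s • z + A *ᵥ z := by
    rw [sub_mulVec, smul_mulVec, one_mulVec]; abel
  refine ⟨z, ⟨hz.1.1, ?_⟩, ?_⟩
  · rw [e]; exact hz.1.2
  · rw [e]; exact hz.2

/-- For `t > ‖A‖`, the map `z ↦ max(0, -t⁻¹(q + Az))` is a contraction, and its fixed point solves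
the problem. -/
theorem exists_forall_sol_add_smul_one (A : Matrix ι ι ℝ) :
    ∃ T : ℝ, ∀ t, T ≤ t → ∀ q, (SOL q (A + t • (1 : Matrix ι ι ℝ))).Nonempty := by
  let L : (ι → ℝ) →L[ℝ] (ι → ℝ) := LinearMap.toContinuousLinearMap (Matrix.toLin' A)
  have hL : ∀ x, L x = A *ᵥ x := fun x => Matrix.toLin'_apply A x
  refine ⟨‖L‖ + 1, fun t ht q => ?_⟩
  have ht0 : 0 < t := by linarith [norm_nonneg L]
  have hcontr : ContractingWith (Real.toNNReal (t⁻¹ * ‖L‖))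
      fun (z : ι → ℝ) (i : ι) => max 0 (-(t⁻¹ * (q + L z) i)) := by
    constructor
    · rw [Real.toNNReal_lt_one, inv_mul_eq_div, div_lt_one ht0]
      linarith
    · refine LipschitzWith.of_dist_le_mul fun z z' => ?_
      rw [Real.coe_toNNReal _ (by positivity)]
      refine (dist_pi_le_iff (by positivity)).2 fun i => ?_
      rw [Real.dist_eq, dist_eq_norm]
      refine (abs_max_sub_max_le_max _ _ _ _).trans ?_
      rw [sub_self, abs_zero, max_eq_right (abs_nonneg _)]
      have e : -(t⁻¹ * (q + L z) i) - -(t⁻¹ * (q + L z') i) = -(t⁻¹ * (L (z - z')) i) := by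
        rw [map_sub]
        simp only [Pi.add_apply, Pi.sub_apply]
        ring
      rw [e, abs_neg, abs_mul, abs_of_pos (inv_pos.2 ht0), mul_assoc]
      gcongr
      exact (norm_le_pi_norm (L (z - z')) i).trans (L.le_opNorm _)
  have hfix := hcontr.fixedPoint_isFixedPt
  set z := ContractingWith.fixedPoint _ hcontr
  have hz : ∀ i, z i = max 0 (-(t⁻¹ * (q + L z) i)) := fun i => (congrFun hfix i).symm
  have hw : ∀ i, (q + (A + t • (1 : Matrix ι ι ℝ)) *ᵥ z) i = (q + L z) i + t * z i := by
    intro i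
    rw [add_smul_one_mulVec, hL]
    simp only [Pi.add_apply, Pi.smul_apply, smul_eq_mul]
    ring
  have hcancel : ∀ i, t * (t⁻¹ * (q + L z) i) = (q + L z) i := fun i => by
    rw [mul_inv_cancel_left₀ ht0.ne']
  refine ⟨z, ⟨fun i => ?_, fun i => ?_⟩, Finset.sum_eq_zero fun i _ => ?_⟩
  · rw [hz i]; exact le_max_left _ _
  · rw [hw, Pi.zero_apply]
    have h1 : -(t⁻¹ * (q + L z) i) ≤ z i := by
      conv_rhs => rw [hz i]
      exact le_max_right _ _
    have := mul_le_mul_of_nonneg_left h1 ht0.le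
    rw [mul_neg, hcancel] at this
    linarith
  · rw [hw]
    rcases max_choice 0 (-(t⁻¹ * (q + L z) i)) with h | h
    · rw [hz i, h, zero_mul]
    · have h1 : z i = -(t⁻¹ * (q + L z) i) := (hz i).trans h
      have : (q + L z) i + t * z i = 0 := by
        rw [h1, mul_neg, hcancel]; ring
      rw [this, mul_zero]

theorem HasPConst.sol_nonempty {A : Matrix ι ι ℝ} {c : ℝ} (hc : 0 < c) (hA : HasPConst A c)
    (q : ι → ℝ) : (SOL q A).Nonempty := by
  obtain ⟨T, hT⟩ := exists_forall_sol_add_smul_one A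
  -- Continuation from large shifts down to zero: the constant `c` survives every shift `t ≥ 0`, so
  -- the step `c / 2` never shrinks.
  have key : ∀ k : ℕ, ∀ t, 0 ≤ t → T - k * (c / 2) ≤ t →
      ∀ q, (SOL q (A + t • (1 : Matrix ι ι ℝ))).Nonempty := by
    intro k
    induction k with
    | zero => exact fun t _ h => hT t (by simpa using h)
    | succ k ih =>
      intro t ht0 ht q
      have h := exists_sol_sub_smul_one (hA.add_smul_one (by linarith : 0 ≤ t + c / 2))
        (by linarith : 0 ≤ c / 2) (by linarith)
        (ih (t + c / 2) (by linarith) (by push_cast at ht; linarith)) q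
      rwa [add_smul, ← add_assoc, add_sub_cancel_right] at h
  obtain ⟨k, hk⟩ := exists_nat_ge (T / (c / 2))
  rw [div_le_iff₀ (by linarith)] at hk
  simpa using key k 0 le_rfl (by linarith) q

/-! ### `Q₀` -/

theorem mem_sol_of_tendsto {A : Matrix ι ι ℝ} {q z : ι → ℝ} {ε : ℕ → ℝ} {u : ℕ → ι → ℝ}
    (hε : Tendsto ε atTop (𝓝 0)) (hu : Tendsto u atTop (𝓝 z))
    (hsol : ∀ k, u k ∈ SOL q (A + ε k • (1 : Matrix ι ι ℝ))) : z ∈ SOL q A := by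
  have hw : Tendsto (fun k => q + (A + ε k • (1 : Matrix ι ι ℝ)) *ᵥ u k) atTop
      (𝓝 (q + A *ᵥ z)) := by
    simp only [add_smul_one_mulVec]
    have h1 := ((continuous_mulVec A).tendsto z).comp hu
    simpa using (h1.add (hε.smul hu)).const_add q
  refine ⟨⟨ge_of_tendsto' hu fun k => (hsol k).1.1, ge_of_tendsto' hw fun k => (hsol k).1.2⟩, ?_⟩
  have h3 : Tendsto (fun k => u k ⬝ᵥ (q + (A + ε k • (1 : Matrix ι ι ℝ)) *ᵥ u k)) atTop
      (𝓝 (z ⬝ᵥ (q + A *ᵥ z))) :=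
    tendsto_finsetSum _ fun i _ => (tendsto_pi_nhds.1 hu i).mul (tendsto_pi_nhds.1 hw i)
  exact tendsto_nhds_unique h3 (by simp only [(hsol _).2]; exact tendsto_const_nhds)

/-- A nonzero recession direction of the regularized solutions certifies infeasibility. -/
theorem IsE0sTilde.fea_eq_empty {A : Matrix ι ι ℝ} (hA : IsE0sTilde A) {q x : ι → ℝ}
    (hx : x ∈ SOL 0 A) {ε : ℝ} (hε : 0 < ε) {z : ι → ℝ}
    (hz : z ∈ SOL q (A + ε • (1 : Matrix ι ι ℝ))) (hx0 : x ≠ 0)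
    (hsupp : ∀ i, 0 < x i → 0 < z i)
    (hsupp' : ∀ i, 0 < (A *ᵥ x) i → 0 < (q + (A + ε • (1 : Matrix ι ι ℝ)) *ᵥ z) i) :
    FEA q A = ∅ := by
  have hxn : 0 ≤ x := hx.1.1
  have hAx : 0 ≤ A *ᵥ x := by simpa using hx.1.2
  have hAtx : Aᵀ *ᵥ x ≤ 0 := hA.1.2 x (by simpa using hx.2) hAx hxn
  have hcompl := SOL.mul_eq_zero hz
  have h1 : x ⬝ᵥ (q + (A + ε • (1 : Matrix ι ι ℝ)) *ᵥ z) = 0 := by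
    refine Finset.sum_eq_zero fun i _ => ?_
    rcases (hxn i).eq_or_lt with h | h
    · rw [← h]; simp
    · rw [(mul_eq_zero.1 (hcompl i)).resolve_left (hsupp i h).ne', mul_zero]
  -- Here the tilde condition enters: `(Aᵀx)ᵢ ≠ 0` gives `(Ax)ᵢ > 0`, hence a positive slack and `zᵢ
  -- = 0`.
  have h2 : (Aᵀ *ᵥ x) ⬝ᵥ z = 0 := by
    refine Finset.sum_eq_zero fun i _ => ?_
    by_cases h : (Aᵀ *ᵥ x) i = 0
    · rw [h, zero_mul]
    · have h3 := hsupp' i ((hAx i).lt_of_ne' (hA.2 x hx i h))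
      rw [(mul_eq_zero.1 (hcompl i)).resolve_right h3.ne', mul_zero]
  have h3 : 0 < x ⬝ᵥ z := by
    obtain ⟨i, hi⟩ := Function.ne_iff.1 hx0
    have hi' : 0 < x i := (hxn i).lt_of_ne' hi
    exact Finset.sum_pos' (fun j _ => mul_nonneg (hxn j) (hz.1.1 j))
      ⟨i, Finset.mem_univ i, mul_pos hi' (hsupp i hi')⟩
  rw [add_smul_one_mulVec, dotProduct_add, dotProduct_add, dotProduct_smul,
    dotProduct_mulVec_eq_transpose_mulVec, h2, smul_eq_mul] at h1
  have hneg : x ⬝ᵥ q < 0 := by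
    have := mul_pos hε h3
    linarith
  refine Set.eq_empty_of_forall_notMem fun y hy => ?_
  have h4 : 0 ≤ x ⬝ᵥ (q + A *ᵥ y) := dotProduct_nonneg_of_nonneg hxn hy.2
  have h5 : (Aᵀ *ᵥ x) ⬝ᵥ y ≤ 0 :=
    Finset.sum_nonpos fun i _ => mul_nonpos_of_nonpos_of_nonneg (hAtx i) (hy.1 i)
  rw [dotProduct_add, dotProduct_mulVec_eq_transpose_mulVec] at h4
  linarith

theorem IsE0sTilde.isQ0 {A : Matrix ι ι ℝ} (hA : IsE0sTilde A) (hP : IsP0 A) : IsQ0 A := by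
  intro q hq
  let ε : ℕ → ℝ := fun k => 1 / ((k : ℝ) + 1)
  have hε : ∀ k, 0 < ε k := fun k => Nat.one_div_pos_of_nat
  have hε0 : Tendsto ε atTop (𝓝 0) := tendsto_one_div_add_atTop_nhds_zero_nat
  have hex : ∀ k, (SOL q (A + ε k • (1 : Matrix ι ι ℝ))).Nonempty := fun k => by
    obtain ⟨c, hc, hPc⟩ := hP.exists_hasPConst (hε k)
    exact hPc.sol_nonempty hc q
  choose u hu using hex
  by_cases hb : ∃ R, ∃ᶠ k in atTop, u k ∈ Metric.closedBall (0 : ι → ℝ) R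
  · obtain ⟨R, hR⟩ := hb
    obtain ⟨z, -, φ, hφ, hlim⟩ := tendsto_subseq_of_frequently_bounded
      Metric.isBounded_closedBall hR
    exact ⟨z, mem_sol_of_tendsto (hε0.comp hφ.tendsto_atTop) hlim fun k => hu (φ k)⟩
  · exfalso
    push Not at hb
    have hinf : Tendsto (fun k => ‖u k‖) atTop atTop := tendsto_atTop.2 fun R =>
      (hb R).mono fun k hk => by
        rw [mem_closedBall_zero_iff, not_le] at hk
        exact hk.le
    let v : ℕ → ι → ℝ := fun k => ‖u k‖⁻¹ • u k
    have hv : ∀ k, v k ∈ Metric.closedBall (0 : ι → ℝ) 1 := fun k => by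
      rw [mem_closedBall_zero_iff, norm_smul, norm_inv, norm_norm]
      exact inv_mul_le_one
    obtain ⟨x, -, φ, hφ, hlim⟩ := tendsto_subseq_of_bounded Metric.isBounded_closedBall hv
    have hφ' := hφ.tendsto_atTop
    have hpos : ∀ᶠ k in atTop, 0 < ‖u (φ k)‖ := (hinf.comp hφ').eventually_gt_atTop 0
    have hw : Tendsto (fun k => ‖u (φ k)‖⁻¹ • (q + (A + ε (φ k) • (1 : Matrix ι ι ℝ)) *ᵥ u (φ k)))
        atTop (𝓝 (A *ᵥ x)) := by
      have h1 := ((continuous_mulVec A).tendsto x).comp hlim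
      have h2 := (tendsto_inv_atTop_zero.comp (hinf.comp hφ')).smul_const q
      have h3 := (hε0.comp hφ').smul hlim
      have h4 := h2.add (h1.add h3)
      rw [zero_smul, zero_smul, zero_add, add_zero] at h4
      refine h4.congr fun k => ?_
      simp only [Function.comp_apply, v, add_smul_one_mulVec, smul_add, mulVec_smul]
      rw [smul_comm (ε (φ k))]
    have hx0 : x ≠ 0 := by
      have h1 : Tendsto (fun k => ‖v (φ k)‖) atTop (𝓝 1) := by
        refine tendsto_const_nhds.congr' (hpos.mono fun k hk => ?_)
        simp only [v]
        rw [norm_smul, norm_inv, norm_norm, inv_mul_cancel₀ hk.ne']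
      have h2 := tendsto_nhds_unique h1 hlim.norm
      rintro rfl
      simp at h2
    have hxsol : x ∈ SOL 0 A := by
      have hvw : ∀ k, v (φ k) ⬝ᵥ
          (‖u (φ k)‖⁻¹ • (q + (A + ε (φ k) • (1 : Matrix ι ι ℝ)) *ᵥ u (φ k))) = 0 := fun k => by
        rw [smul_dotProduct, dotProduct_smul, (hu (φ k)).2, smul_zero, smul_zero]
      have h3 : Tendsto (fun k => v (φ k) ⬝ᵥ
          (‖u (φ k)‖⁻¹ • (q + (A + ε (φ k) • (1 : Matrix ι ι ℝ)) *ᵥ u (φ k)))) atTop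
          (𝓝 (x ⬝ᵥ (A *ᵥ x))) :=
        tendsto_finsetSum _ fun i _ => (tendsto_pi_nhds.1 hlim i).mul (tendsto_pi_nhds.1 hw i)
      simp only [hvw] at h3
      refine ⟨⟨ge_of_tendsto' hlim fun k =>
        smul_nonneg (inv_nonneg.2 (norm_nonneg _)) (hu (φ k)).1.1, ?_⟩, ?_⟩
      · rw [zero_add]
        exact ge_of_tendsto' hw fun k =>
          smul_nonneg (inv_nonneg.2 (norm_nonneg _)) (hu (φ k)).1.2
      · rw [zero_add]
        exact tendsto_nhds_unique h3 tendsto_const_nhds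
    -- Positive coordinates of the limits are eventually positive along the sequence; a single such
    -- index suffices for the certificate.
    have hev1 : ∀ᶠ k in atTop, ∀ i, 0 < x i → 0 < u (φ k) i := by
      refine eventually_all.2 fun i => ?_
      by_cases hi : 0 < x i
      · filter_upwards [(tendsto_pi_nhds.1 hlim i).eventually_const_lt hi] with k hk _
        exact pos_of_mul_pos_right hk (inv_nonneg.2 (norm_nonneg _))
      · exact Eventually.of_forall fun k h => absurd h hi
    have hev2 : ∀ᶠ k in atTop, ∀ i, 0 < (A *ᵥ x) i →
        0 < (q + (A + ε (φ k) • (1 : Matrix ι ι ℝ)) *ᵥ u (φ k)) i := by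
      refine eventually_all.2 fun i => ?_
      by_cases hi : 0 < (A *ᵥ x) i
      · filter_upwards [(tendsto_pi_nhds.1 hw i).eventually_const_lt hi] with k hk _
        exact pos_of_mul_pos_right hk (inv_nonneg.2 (norm_nonneg _))
      · exact Eventually.of_forall fun k h => absurd h hi
    obtain ⟨k, hk1, hk2⟩ := (hev1.and hev2).exists
    exact hq.ne_empty (hA.fea_eq_empty hxsol (hε _) (hu _) hx0 hk1 hk2)

end Fintype

end LCP

theorem mainTheorem1 (n : ℕ) (A : Matrix (Fin n) (Fin n) ℝ) (hA : LCP.IsE0sTilde A) :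
    (LCP.IsE0 A ∧ LCP.IsL2 A) ∧
    ((∀ M : Matrix (Fin n) (Fin n) ℝ, LCP.IsLegitimatePPT A M →
        LCP.IsAlmostE M ∨ LCP.IsCompletelyE0sTilde M) →
      LCP.IsP0 A ∧ LCP.IsQ0 A) := by
  refine ⟨⟨hA.1.1, hA.isL2⟩, fun h => ?_⟩
  have hP : LCP.IsP0 A := by
    -- At order one, almost `E` does not make the diagonal positive, so `E₀` is used directly.
    rcases Nat.lt_or_ge 1 n with hn | hn
    · exact LCP.isP0_of_ppt (by rwa [Fintype.card_fin]) h
    · exact hA.1.1.isP0_of_card_le_one (by rwa [Fintype.card_fin])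
  exact ⟨hP, hA.isQ0 hP⟩
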